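/- Let $(M,\phi,\xi,\eta,g)$ be a Sasakian manifold, i.e. a smooth manifold with a Riemannian metric $g$, a smooth $(1,1)$-tensor field $\phi$, a smooth vector field $\xi$ and a smooth 1-form $\eta$ such that $\phi^2=-I+\eta\otimes\xi$, $\eta(\xi)=1$, $\eta\circ\phi=0$, $\phi\xi=0$, $g(\phi X,\phi Y)=g(X,Y)-\eta(X)\eta(Y)$, $g(X,\phi Y)=d\eta(X,Y)$ and $[\phi,\phi]+2\,d\eta\otimes\xi=0$, where $2\,d\eta(X,Y)=X\eta(Y)-Y\eta(X)-\eta([X,Y])$ and $[\phi,\phi]$ is the Nijenhuis tensor of $\phi$. Let $(N,g')$ be a Riemannian manifold and let $F:M\to N$ be a bi-slant $\xi^{\perp}$-Riemannian submersion with distributions $D_1,D_2$ and bi-slant angles $\theta_1,\theta_2$. That is, $F$ is a smooth surjection of maximal rank whose differential preserves the lengths of horizontal vectors; $\xi$ is horizontal; $\ker F_*=D_1\oplus D_2$ is an orthogonal direct sum of smooth distributions; $\phi D_1\perp D_2$ and $\phi D_2\perp D_1$; and for $i=1,2$, every $p\in M$ and every nonzero $X\in (D_i)_p$, the angle between $\phi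 X$ and the space $(D_i)_p$ equals the constant $\theta_i$. Let $\nabla$ be the Levi-Civita connection of $g$, let $\mathcal V$ and $\mathcal H$ be the orthogonal projections onto $\ker F_*$ and $(\ker F_*)^\perp$, and let $T_XY=\mathcal H\nabla_{\mathcal VX}\mathcal VY+\mathcal V\nabla_{\mathcal VX}\mathcal HY$. For a vertical vector field $U$ write $\phi U=\varphi U+\omega U$ with $\varphi U=\mathcal V\phi U$ and $\omega U=\mathcal H\phi U$. A distribution $D$ is called integrable if $[X,Y]\in\Gamma(D)$ for all $X,Y\in\Gamma(D)$, where $\Gamma(D)$ denotes the smooth vector fields on $M$ with values in $D$. (i) $D_1$ is integrable if and only if, for all $U,V\in\Gamma(D_1)$ and $W\in\Gamma(D_2)$, $$g\left(T_U\omega\varphi V-T_V\omega\varphi U,\,W\right)=g\left(T_U\omega V-T_V\omega U,\,\varphi W\right)+g\left(\mathcal H\nabla_U\omega V-\mathcal H\nabla_V\omega U,\,\omega W\right).$$ (ii) $D_2$ is integrable if and only if, for all $W,Z\in\Gamma(D_2)$ and $U\in\Gamma(D_1)$, $$g\left(T_W\omega\varphi Z-T_Z\omega\varphi W,\,U\right)=g\left(T_W\omega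 Z-T_Z\omega W,\,\varphi U\right)+g\left(\mathcal H\nabla_W\omega Z-\mathcal H\nabla_Z\omega W,\,\omega U\right).$$ -/

import Mathlib

open Bundle Manifold VectorField
open scoped ContDiff Topology InnerProductSpace

noncomputable section

namespace BiSlant

section LeviCivita

variable {E : Type*} [NormedAddCommGroup E] [NormedSpace ℝ E]
  {M : Type*} [TopologicalSpace M] [ChartedSpace E M] [IsManifold 𝓘(ℝ, E) ∞ M]
  [RiemannianBundle (fun x : M => TangentSpace 𝓘(ℝ, E) x)]

/-- The function `X g(Y, Z)`. -/
def dInner (X Y Z : ∀ x : M, TangentSpace 𝓘(ℝ, E) x) (x : M) : ℝ :=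
  mvfderiv 𝓘(ℝ, E) (fun y => ⟪Y y, Z y⟫_ℝ) x (X x)

/-- The right-hand side of the Koszul formula, which equals `2 g(∇_X Y, Z)`. -/
def koszul (X Y Z : ∀ x : M, TangentSpace 𝓘(ℝ, E) x) (x : M) : ℝ :=
  dInner X Y Z x + dInner Y Z X x - dInner Z X Y x
    + ⟪mlieBracket 𝓘(ℝ, E) X Y x, Z x⟫_ℝ
    - ⟪mlieBracket 𝓘(ℝ, E) Y Z x, X x⟫_ℝ
    + ⟪mlieBracket 𝓘(ℝ, E) Z X x, Y x⟫_ℝ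

theorem dInner_comm (X Y Z : ∀ x : M, TangentSpace 𝓘(ℝ, E) x) (x : M) : dInner X Y Z x = dInner X Z Y x := by
  simp only [dInner, real_inner_comm]

variable [IsContMDiffRiemannianBundle 𝓘(ℝ, E) ∞ E (fun x : M => TangentSpace 𝓘(ℝ, E) x)]
  {X X' Y Y' Z Z' : ∀ x : M, TangentSpace 𝓘(ℝ, E) x} {f : M → ℝ} {x : M}

theorem mdifferentiableAt_inner (hY : MDiffAt (T% Y) x) (hZ : MDiffAt (T% Z) x) :
    MDiffAt (fun y => ⟪Y y, Z y⟫_ℝ) x :=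
  MDifferentiableAt.inner_bundle (IB := 𝓘(ℝ, E)) (F := E)
    (E := fun x : M => TangentSpace 𝓘(ℝ, E) x) (b := fun y => y) hY hZ

theorem dInner_smul (hf : MDiffAt f x) (hY : MDiffAt (T% Y) x) (hZ : MDiffAt (T% Z) x) :
    dInner X (f • Y) Z x
      = f x * dInner X Y Z x + mvfderiv 𝓘(ℝ, E) f x (X x) * ⟪Y x, Z x⟫_ℝ := by
  simp only [dInner, Pi.smul_apply', real_inner_smul_left]
  rw [mvfderiv_fun_mul hf (mdifferentiableAt_inner hY hZ)]
  simp
  ring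

theorem dInner_add (hY : MDiffAt (T% Y) x) (hY' : MDiffAt (T% Y') x) (hZ : MDiffAt (T% Z) x) :
    dInner X (Y + Y') Z x = dInner X Y Z x + dInner X Y' Z x := by
  simp only [dInner, Pi.add_apply, inner_add_left]
  rw [mvfderiv_fun_add (mdifferentiableAt_inner hY hZ) (mdifferentiableAt_inner hY' hZ)]
  simp
  
theorem tensorialAt_koszul_left [CompleteSpace E] (hY : MDiffAt (T% Y) x) (hZ : MDiffAt (T% Z) x) :
    TensorialAt 𝓘(ℝ, E) E (fun X => koszul X Y Z x) x where
  smul {f X} hf hX := by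
    simp only [koszul, dInner_comm Y Z, dInner_smul hf hX hY, dInner_smul hf hX hZ,
      mlieBracket_smul_left hf hX, mlieBracket_smul_right hf hX]
    simp only [dInner, Pi.smul_apply', inner_add_left, real_inner_smul_left, real_inner_smul_right,
      map_smul, smul_eq_mul, real_inner_comm (Y x) (X x), real_inner_comm (Z x) (X x)]
    simp only [real_inner_comm]
    ring
  add {X X'} hX hX' := by
    simp only [koszul, dInner_comm Y Z, dInner_add hX hX' hY, dInner_add hX hX' hZ,
      mlieBracket_add_left hX hX', mlieBracket_add_right hX hX']
    simp [dInner, inner_add_right, inner_add_left]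
    ring

theorem tensorialAt_koszul_right [CompleteSpace E] (hX : MDiffAt (T% X) x)
    (hY : MDiffAt (T% Y) x) :
    TensorialAt 𝓘(ℝ, E) E (fun Z => koszul X Y Z x) x where
  smul {f Z} hf hZ := by
    simp only [koszul, dInner_comm X Y, dInner_smul hf hZ hY, dInner_smul hf hZ hX,
      mlieBracket_smul_left hf hZ, mlieBracket_smul_right hf hZ]
    simp only [dInner, Pi.smul_apply', inner_add_left, real_inner_smul_left, real_inner_smul_right,
      map_smul, smul_eq_mul, real_inner_comm (Y x) (Z x), real_inner_comm (X x) (Z x)]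
    simp only [real_inner_comm]
    ring
  add {Z Z'} hZ hZ' := by
    simp only [koszul, dInner_comm X Y, dInner_add hZ hZ' hY, dInner_add hZ hZ' hX,
      mlieBracket_add_left hZ hZ', mlieBracket_add_right hZ hZ']
    simp [dInner, inner_add_right, inner_add_left]
    ring

theorem koszul_add [CompleteSpace E] (hX : MDiffAt (T% X) x) (hY : MDiffAt (T% Y) x)
    (hY' : MDiffAt (T% Y') x) (hZ : MDiffAt (T% Z) x) :
    koszul X (Y + Y') Z x = koszul X Y Z x + koszul X Y' Z x := by
  simp only [koszul, dInner_comm Z X, dInner_add hY hY' hX, dInner_add hY hY' hZ,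
    mlieBracket_add_left hY hY', mlieBracket_add_right hY hY']
  simp [dInner, inner_add_right, inner_add_left]
  ring

theorem koszul_smul [CompleteSpace E] (hX : MDiffAt (T% X) x) (hf : MDiffAt f x)
    (hY : MDiffAt (T% Y) x) (hZ : MDiffAt (T% Z) x) :
    koszul X (f • Y) Z x
      = f x * koszul X Y Z x + 2 * (mvfderiv 𝓘(ℝ, E) f x (X x) * ⟪Y x, Z x⟫_ℝ) := by
  simp only [koszul, dInner_comm Z X, dInner_smul hf hY hX, dInner_smul hf hY hZ,
    mlieBracket_smul_left hf hY, mlieBracket_smul_right hf hY]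
  simp only [dInner, Pi.smul_apply', inner_add_left, real_inner_smul_left, real_inner_smul_right,
    map_smul, smul_eq_mul, real_inner_comm (X x) (Y x)]
  simp only [real_inner_comm]
  ring

/-- Tangent spaces of a finite-dimensional manifold are finite-dimensional. -/
instance [FiniteDimensional ℝ E] (x : M) : FiniteDimensional ℝ (TangentSpace 𝓘(ℝ, E) x) :=
  inferInstanceAs (FiniteDimensional ℝ E)

variable [FiniteDimensional ℝ E]

variable (Y x) in
/-- The bilinear form `(v, w) ↦ 2 g(∇_v Y, w)` on the tangent space at `x`. -/
def koszulForm (hY : MDiffAt (T% Y) x) :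
    TangentSpace 𝓘(ℝ, E) x →L[ℝ] TangentSpace 𝓘(ℝ, E) x →L[ℝ] ℝ :=
  haveI : CompleteSpace E := FiniteDimensional.complete ℝ E
  TensorialAt.mkHom₂ (I := 𝓘(ℝ, E)) (F := E) (F' := E) (fun X Z => koszul X Y Z x) x
    (fun _ hZ => tensorialAt_koszul_left hY hZ) (fun _ hX => tensorialAt_koszul_right hX hY)

theorem koszulForm_apply (hX : MDiffAt (T% X) x) (hY : MDiffAt (T% Y) x)
    (hZ : MDiffAt (T% Z) x) : koszulForm Y x hY (X x) (Z x) = koszul X Y Z x :=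
  haveI : CompleteSpace E := FiniteDimensional.complete ℝ E
  TensorialAt.mkHom₂_apply (I := 𝓘(ℝ, E)) (F := E) (F' := E)
    (fun _ hZ => tensorialAt_koszul_left hY hZ) (fun _ hX => tensorialAt_koszul_right hX hY) hX hZ

open Classical in
/-- `∇Y` at `x`. -/
def leviCivitaFun (Y : ∀ x : M, TangentSpace 𝓘(ℝ, E) x) (x : M) :
    TangentSpace 𝓘(ℝ, E) x →L[ℝ] TangentSpace 𝓘(ℝ, E) x :=
  if hY : MDiffAt (T% Y) x then
    ∑ i, ((1 / 2 : ℝ) • (koszulForm Y x hY).flip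
      (stdOrthonormalBasis ℝ (TangentSpace 𝓘(ℝ, E) x) i)).smulRight
        (stdOrthonormalBasis ℝ (TangentSpace 𝓘(ℝ, E) x) i)
  else 0

theorem inner_leviCivitaFun_form (hY : MDiffAt (T% Y) x) (v w : TangentSpace 𝓘(ℝ, E) x) :
    2 * ⟪leviCivitaFun Y x v, w⟫_ℝ = koszulForm Y x hY v w := by
  have hw := (stdOrthonormalBasis ℝ (TangentSpace 𝓘(ℝ, E) x)).sum_repr' w
  rw [leviCivitaFun, dif_pos hY]
  conv_rhs => rw [← hw]
  simp [sum_inner, real_inner_smul_left, Finset.mul_sum]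
  refine Finset.sum_congr rfl fun i _ => ?_
  ring

/-- The Koszul formula, for vector fields that are differentiable at `x`. -/
theorem inner_leviCivitaFun (hX : MDiffAt (T% X) x) (hY : MDiffAt (T% Y) x)
    (hZ : MDiffAt (T% Z) x) :
    2 * ⟪leviCivitaFun Y x (X x), Z x⟫_ℝ = koszul X Y Z x := by
  rw [inner_leviCivitaFun_form hY, koszulForm_apply hX hY hZ]

variable (E M) in
/-- The Levi-Civita connection, defined by the Koszul formula
`2 g(∇_X Y, Z) = X g(Y, Z) + Y g(Z, X) - Z g(X, Y) + g([X, Y], Z) - g([Y, Z], X) + g([Z, X], Y)`.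
Mathlib's argument order: `leviCivita E M Y x v` is `∇_v Y` at `x`. -/
def leviCivita : CovariantDerivative 𝓘(ℝ, E) E (fun x : M => TangentSpace 𝓘(ℝ, E) x) where
  toFun := leviCivitaFun
  isCovariantDerivativeOnUniv :=
    haveI : CompleteSpace E := FiniteDimensional.complete ℝ E
    { add := by
        intro Y Y' x hY hY' _
        ext1 v
        refine ext_inner_right ℝ fun w => ?_
        have hv := FiberBundle.mdifferentiableAt_extend 𝓘(ℝ, E) E v
        have hw := FiberBundle.mdifferentiableAt_extend 𝓘(ℝ, E) E w
        have h1 := inner_leviCivitaFun hv hY hw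
        have h2 := inner_leviCivitaFun hv hY' hw
        have h3 := inner_leviCivitaFun hv (mdifferentiableAt_add_section hY hY') hw
        rw [koszul_add hv hY hY' hw] at h3
        simp only [FiberBundle.extend_apply_self] at h1 h2 h3
        rw [add_apply, inner_add_left]
        linarith
      leibniz := by
        intro Y f x hY hf _
        ext1 v
        refine ext_inner_right ℝ fun w => ?_
        have hv := FiberBundle.mdifferentiableAt_extend 𝓘(ℝ, E) E v
        have hw := FiberBundle.mdifferentiableAt_extend 𝓘(ℝ, E) E w
        have h1 := inner_leviCivitaFun hv hY hw
        have h3 := inner_leviCivitaFun hv (hf.smul_section hY) hw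
        rw [koszul_smul hv hf hY hw] at h3
        simp only [FiberBundle.extend_apply_self] at h1 h3
        rw [add_apply, inner_add_left, ContinuousLinearMap.smulRight_apply, smul_apply,
          real_inner_smul_left, real_inner_smul_left]
        linear_combination h3 / 2 - f x * h1 / 2 }

/-- The Levi-Civita connection is torsion-free. -/
theorem leviCivita_torsion_free (hX : MDiffAt (T% X) x) (hY : MDiffAt (T% Y) x) :
    leviCivita E M Y x (X x) - leviCivita E M X x (Y x) = mlieBracket 𝓘(ℝ, E) X Y x := by
  refine ext_inner_right ℝ fun w => ?_
  have hw := FiberBundle.mdifferentiableAt_extend 𝓘(ℝ, E) E w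
  have h1 := inner_leviCivitaFun hX hY hw
  have h2 := inner_leviCivitaFun hY hX hw
  change ⟪leviCivitaFun Y x (X x) - leviCivitaFun X x (Y x), w⟫_ℝ = _
  set W := FiberBundle.extend E w
  have hW : W x = w := by simp [W]
  simp only [koszul, dInner_comm Y X, dInner_comm X W, dInner_comm W Y,
    mlieBracket_swap_apply (V := Y) (W := X), mlieBracket_swap_apply (V := X) (W := W),
    mlieBracket_swap_apply (V := W) (W := Y), inner_neg_left, hW] at h1 h2
  rw [inner_sub_left]
  linarith

/-- The Levi-Civita connection is compatible with the metric. -/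
theorem leviCivita_metric (hX : MDiffAt (T% X) x) (hY : MDiffAt (T% Y) x) (hZ : MDiffAt (T% Z) x) :
    mvfderiv 𝓘(ℝ, E) (fun y => ⟪Y y, Z y⟫_ℝ) x (X x)
      = ⟪leviCivita E M Y x (X x), Z x⟫_ℝ + ⟪Y x, leviCivita E M Z x (X x)⟫_ℝ := by
  have h1 := inner_leviCivitaFun hX hY hZ
  have h2 := inner_leviCivitaFun hX hZ hY
  change dInner X Y Z x = ⟪leviCivitaFun Y x (X x), Z x⟫_ℝ + ⟪Y x, leviCivitaFun Z x (X x)⟫_ℝ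
  simp only [koszul, dInner_comm X Z, dInner_comm Z Y, dInner_comm Y X,
    mlieBracket_swap_apply (V := Z) (W := Y), mlieBracket_swap_apply (V := Y) (W := X),
    mlieBracket_swap_apply (V := X) (W := Z), inner_neg_left] at h1 h2
  rw [real_inner_comm _ (Y x)]
  linarith

end LeviCivita

section Distribution

variable {E : Type*} [NormedAddCommGroup E] [NormedSpace ℝ E]
  {M : Type*} [TopologicalSpace M] [ChartedSpace E M] [IsManifold 𝓘(ℝ, E) ∞ M]

/-- `U ∈ Γ(D)`: `U` is a smooth vector field on `M` with values in `D`. -/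
def IsSection (D : ∀ x : M, Submodule ℝ (TangentSpace 𝓘(ℝ, E) x))
    (U : ∀ x : M, TangentSpace 𝓘(ℝ, E) x) : Prop :=
  CMDiff ∞ (T% U) ∧ ∀ x, U x ∈ D x

/-- A smooth distribution (vector subbundle of `TM`): near every point it has a frame of smooth
vector fields. -/
def IsSmoothDistribution (D : ∀ x : M, Submodule ℝ (TangentSpace 𝓘(ℝ, E) x)) : Prop :=
  ∀ x : M, ∃ (k : ℕ) (X : Fin k → ∀ y : M, TangentSpace 𝓘(ℝ, E) y), ∀ᶠ y in 𝓝 x,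
    (∀ i, CMDiffAt ∞ (T% (X i)) y) ∧ LinearIndependent ℝ (fun i => X i y) ∧
      Submodule.span ℝ (Set.range fun i => X i y) = D y

/-- A distribution is (completely) integrable, or involutive: `[U, V] ∈ Γ(D)` for all
`U, V ∈ Γ(D)`. -/
def IsIntegrable (D : ∀ x : M, Submodule ℝ (TangentSpace 𝓘(ℝ, E) x)) : Prop :=
  ∀ U V : ∀ x : M, TangentSpace 𝓘(ℝ, E) x, IsSection D U → IsSection D V →
    ∀ x, mlieBracket 𝓘(ℝ, E) U V x ∈ D x

end Distribution

section Sasakian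

variable (E : Type*) [NormedAddCommGroup E] [NormedSpace ℝ E]
  (M : Type*) [TopologicalSpace M] [ChartedSpace E M] [IsManifold 𝓘(ℝ, E) ∞ M]
  [RiemannianBundle (fun x : M => TangentSpace 𝓘(ℝ, E) x)]

/-- An almost contact structure `(φ, ξ, η)` on `M` compatible with the Riemannian metric of `M`. -/
structure AlmostContactMetric where
  /-- the tensor field of type `(1, 1)` -/
  φ : ∀ x : M, TangentSpace 𝓘(ℝ, E) x →L[ℝ] TangentSpace 𝓘(ℝ, E) x
  /-- the Reeb vector field -/
  ξ : ∀ x : M, TangentSpace 𝓘(ℝ, E) x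
  /-- the contact form -/
  η : ∀ x : M, TangentSpace 𝓘(ℝ, E) x →L[ℝ] ℝ
  smooth_φ : ContMDiff 𝓘(ℝ, E) (𝓘(ℝ, E).prod 𝓘(ℝ, E →L[ℝ] E)) ∞
    (fun x => TotalSpace.mk' (E →L[ℝ] E)
      (E := fun x : M => TangentSpace 𝓘(ℝ, E) x →L[ℝ] TangentSpace 𝓘(ℝ, E) x) x (φ x))
  smooth_ξ : CMDiff ∞ (T% ξ)
  smooth_η : ContMDiff 𝓘(ℝ, E) (𝓘(ℝ, E).prod 𝓘(ℝ, E →L[ℝ] ℝ)) ∞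
    (fun x => TotalSpace.mk' (E →L[ℝ] ℝ)
      (E := fun x : M => TangentSpace 𝓘(ℝ, E) x →L[ℝ] Bundle.Trivial M ℝ x) x (η x))
  φ_φ : ∀ x v, φ x (φ x v) = -v + η x v • ξ x
  η_ξ : ∀ x, η x (ξ x) = 1
  η_φ : ∀ x v, η x (φ x v) = 0
  φ_ξ : ∀ x, φ x (ξ x) = 0
  inner_φ_φ : ∀ x v w, ⟪φ x v, φ x w⟫_ℝ = ⟪v, w⟫_ℝ - η x v * η x w

variable {E M}

namespace AlmostContactMetric

variable (S : AlmostContactMetric E M)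

/-- The vector field `φX`. -/
def phi (X : ∀ x : M, TangentSpace 𝓘(ℝ, E) x) (x : M) : TangentSpace 𝓘(ℝ, E) x := S.φ x (X x)

/-- `dη(X, Y) = (X η(Y) - Y η(X) - η([X, Y])) / 2`. -/
def dη (X Y : ∀ x : M, TangentSpace 𝓘(ℝ, E) x) (x : M) : ℝ :=
  (1 / 2 : ℝ) * (mvfderiv 𝓘(ℝ, E) (fun y => S.η y (Y y)) x (X x)
    - mvfderiv 𝓘(ℝ, E) (fun y => S.η y (X y)) x (Y x)
    - S.η x (mlieBracket 𝓘(ℝ, E) X Y x))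

/-- The Nijenhuis tensor
`[φ, φ](X, Y) = φ²[X, Y] + [φX, φY] - φ[φX, Y] - φ[X, φY]`. -/
def nijenhuis (X Y : ∀ x : M, TangentSpace 𝓘(ℝ, E) x) (x : M) : TangentSpace 𝓘(ℝ, E) x :=
  S.φ x (S.φ x (mlieBracket 𝓘(ℝ, E) X Y x)) + mlieBracket 𝓘(ℝ, E) (S.phi X) (S.phi Y) x
    - S.φ x (mlieBracket 𝓘(ℝ, E) (S.phi X) Y x) - S.φ x (mlieBracket 𝓘(ℝ, E) X (S.phi Y) x)

/-- A Sasakian structure is a normal contact metric structure: `Φ = dη`, where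
`Φ(X, Y) = g(X, φY)`, and `[φ, φ] + 2 dη ⊗ ξ = 0`. -/
structure IsSasakian : Prop where
  contact : ∀ X Y : ∀ x : M, TangentSpace 𝓘(ℝ, E) x, CMDiff ∞ (T% X) → CMDiff ∞ (T% Y) →
    ∀ x, ⟪X x, S.φ x (Y x)⟫_ℝ = S.dη X Y x
  normal : ∀ X Y : ∀ x : M, TangentSpace 𝓘(ℝ, E) x, CMDiff ∞ (T% X) → CMDiff ∞ (T% Y) →
    ∀ x, S.nijenhuis X Y x + (2 * S.dη X Y x) • S.ξ x = 0

end AlmostContactMetric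

end Sasakian

section Submersion

variable {E : Type*} [NormedAddCommGroup E] [NormedSpace ℝ E] [FiniteDimensional ℝ E]
  {M : Type*} [TopologicalSpace M] [ChartedSpace E M] [IsManifold 𝓘(ℝ, E) ∞ M]
  [RiemannianBundle (fun x : M => TangentSpace 𝓘(ℝ, E) x)]
  (E' : Type*) [NormedAddCommGroup E'] [NormedSpace ℝ E']
  {N : Type*} [TopologicalSpace N] [ChartedSpace E' N] [IsManifold 𝓘(ℝ, E') ∞ N]

/-- The vertical space `ker F_*` at `x`. -/
def vertical (F : M → N) (x : M) : Submodule ℝ (TangentSpace 𝓘(ℝ, E) x) :=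
  (mfderiv 𝓘(ℝ, E) 𝓘(ℝ, E') F x).ker

/-- The vertical part `𝓥X` of a vector field. -/
def verPart (F : M → N) (X : ∀ x : M, TangentSpace 𝓘(ℝ, E) x) (x : M) :
    TangentSpace 𝓘(ℝ, E) x :=
  (vertical E' F x).starProjection (X x)

/-- The horizontal part `𝓗X` of a vector field. -/
def horPart (F : M → N) (X : ∀ x : M, TangentSpace 𝓘(ℝ, E) x) (x : M) :
    TangentSpace 𝓘(ℝ, E) x :=
  (vertical E' F x)ᗮ.starProjection (X x)

variable (E) in
/-- A Riemannian submersion: a smooth surjection of maximal rank whose differential preserves the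
lengths of horizontal vectors. -/
structure IsRiemannianSubmersion [RiemannianBundle (fun y : N => TangentSpace 𝓘(ℝ, E') y)]
    (F : M → N) : Prop where
  smooth : ContMDiff 𝓘(ℝ, E) 𝓘(ℝ, E') ∞ F
  surjective : Function.Surjective F
  maximal_rank : ∀ x, Function.Surjective (mfderiv 𝓘(ℝ, E) 𝓘(ℝ, E') F x)
  norm_map : ∀ x, ∀ v ∈ (vertical E' F x)ᗮ, ‖mfderiv 𝓘(ℝ, E) 𝓘(ℝ, E') F x v‖ = ‖v‖

/-- The vertical part `φ̂U` of `φU` (written `φU = φ̂U + ωU` for vertical `U`). -/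
def phiHat (S : AlmostContactMetric E M) (F : M → N) (U : ∀ x : M, TangentSpace 𝓘(ℝ, E) x) :
    ∀ x : M, TangentSpace 𝓘(ℝ, E) x :=
  verPart E' F (S.phi U)

/-- The horizontal part `ωU` of `φU`. -/
def omega (S : AlmostContactMetric E M) (F : M → N) (U : ∀ x : M, TangentSpace 𝓘(ℝ, E) x) :
    ∀ x : M, TangentSpace 𝓘(ℝ, E) x :=
  horPart E' F (S.phi U)

/-- The distribution `D` is slant with angle `θ`: for every nonzero `X ∈ D_p`, the angle between
`φX` and the space `D_p`, i.e. between `φX` and its orthogonal projection to `D_p`, equals `θ`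
(and hence depends neither on `p` nor on `X`). -/
def IsSlant (S : AlmostContactMetric E M) (D : ∀ x : M, Submodule ℝ (TangentSpace 𝓘(ℝ, E) x))
    (θ : ℝ) : Prop :=
  ∀ x, ∀ v ∈ D x, v ≠ 0 →
    InnerProductGeometry.angle (S.φ x v) ((D x).starProjection (S.φ x v)) = θ

/-- A bi-slant `ξᗮ`-Riemannian submersion with distributions `D₁`, `D₂` and bi-slant angles
`θ₁`, `θ₂`: a Riemannian submersion with horizontal Reeb field whose vertical distribution is the
orthogonal direct sum of the slant distributions `D₁`, `D₂`, with `φD₁ ⟂ D₂` and `φD₂ ⟂ D₁`. -/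
structure IsBiSlantSubmersion [RiemannianBundle (fun y : N => TangentSpace 𝓘(ℝ, E') y)]
    (S : AlmostContactMetric E M) (F : M → N)
    (D₁ D₂ : ∀ x : M, Submodule ℝ (TangentSpace 𝓘(ℝ, E) x)) (θ₁ θ₂ : ℝ) : Prop where
  riemannian : IsRiemannianSubmersion E E' F
  reeb_horizontal : ∀ x, S.ξ x ∈ (vertical E' F x)ᗮ
  smooth₁ : IsSmoothDistribution D₁
  smooth₂ : IsSmoothDistribution D₂
  sup_eq : ∀ x, D₁ x ⊔ D₂ x = vertical E' F x
  orthogonal : ∀ x, D₁ x ⟂ D₂ x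
  slant₁ : IsSlant S D₁ θ₁
  slant₂ : IsSlant S D₂ θ₂
  φ_orthogonal₁ : ∀ x, ∀ u ∈ D₁ x, ∀ w ∈ D₂ x, ⟪S.φ x u, w⟫_ℝ = 0
  φ_orthogonal₂ : ∀ x, ∀ w ∈ D₂ x, ∀ u ∈ D₁ x, ⟪S.φ x w, u⟫_ℝ = 0

variable [IsContMDiffRiemannianBundle 𝓘(ℝ, E) ∞ E (fun x : M => TangentSpace 𝓘(ℝ, E) x)]

/-- The vector field `∇_X Y`. -/
def nabla (X Y : ∀ x : M, TangentSpace 𝓘(ℝ, E) x) (x : M) : TangentSpace 𝓘(ℝ, E) x :=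
  leviCivita E M Y x (X x)

/-- O'Neill's tensor `T_X Y = 𝓗 ∇_{𝓥X} 𝓥Y + 𝓥 ∇_{𝓥X} 𝓗Y`. -/
def oneillT (F : M → N) (X Y : ∀ x : M, TangentSpace 𝓘(ℝ, E) x) :
    ∀ x : M, TangentSpace 𝓘(ℝ, E) x :=
  horPart E' F (nabla (verPart E' F X) (verPart E' F Y))
    + verPart E' F (nabla (verPart E' F X) (horPart E' F Y))

/-- The horizontal part `𝓗 ∇_X Y`. -/
def horNabla (F : M → N) (X Y : ∀ x : M, TangentSpace 𝓘(ℝ, E) x) :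
    ∀ x : M, TangentSpace 𝓘(ℝ, E) x :=
  horPart E' F (nabla X Y)

end Submersion

end BiSlant

end

open BiSlant

/-! Everything rests on one identity. For U, V in Γ(D₁) and W in Γ(D₂), sin²θ₁ · g(∇_U V, W) equals
-g(T_U ωφ̂V, W) + g(T_U ωV, φ̂W) + g(𝓗∇_U ωV, ωW) (`inner_nabla`). Since ξ is horizontal, η vanishes
on vertical vectors, and for fields in ker η the Sasakian condition makes (∇_U φ)V a multiple of ξ
(`inner_nabla_phi`). Hence g(∇_U V, W) = g(∇_U φV, φW). Splitting φV = φ̂V + ωV and moving φ across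
once more in the φ̂V term produces ∇_U φ̂²V, and φ̂² = -cos²θ₁ on D₁ by the slant condition
(`phiHat_phiHat`). This accounts for the factor 1 - cos²θ₁.

Antisymmetrizing in U and V, the two sides of the stated equation differ by sin²θ₁ · g([U, V], W)
(`inner_mlieBracket`). Integrability therefore gives the equation because D₁ ⟂ D₂. Conversely, if
sin θ₁ ≠ 0, then [U, V] is vertical, as ker F_* is involutive, and orthogonal to D₂, so it lies in
D₁. If sin θ₁ = 0 the identity carries no information, but then D₁ has no nonzero section: η([U,
φ̂U]) = 2|U|², while [U, φ̂U] is vertical. -/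

namespace BiSlant

/-! ### Involutivity of the kernel of a differential. -/

section Involutive

variable {E : Type*} [NormedAddCommGroup E] [NormedSpace ℝ E]
  {M : Type*} [TopologicalSpace M] [ChartedSpace E M] [IsManifold 𝓘(ℝ, E) ∞ M]
  {E' : Type*} [NormedAddCommGroup E'] [NormedSpace ℝ E']
  {N : Type*} [TopologicalSpace N] [ChartedSpace E' N] [IsManifold 𝓘(ℝ, E') ∞ N]

/-- The pullback of a field of kernel vectors to a chart consists of kernel vectors of the
coordinate expression of the map. -/
theorem eventually_fderiv_writtenInExtChartAt_mpullbackWithin {F : M → N}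
    (hF : ContMDiff 𝓘(ℝ, E) 𝓘(ℝ, E') ∞ F) {V : ∀ x : M, TangentSpace 𝓘(ℝ, E) x}
    (hV : ∀ x, mfderiv 𝓘(ℝ, E) 𝓘(ℝ, E') F x (V x) = 0) (x : M) :
    ∀ᶠ y in 𝓝 (extChartAt 𝓘(ℝ, E) x x),
      fderiv ℝ (writtenInExtChartAt 𝓘(ℝ, E) 𝓘(ℝ, E') x F) y
        (mpullbackWithin 𝓘(ℝ, E) 𝓘(ℝ, E) (extChartAt 𝓘(ℝ, E) x).symm V
          (Set.range 𝓘(ℝ, E)) y) = 0 := by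
  have h1 : ∀ᶠ y in 𝓝 (extChartAt 𝓘(ℝ, E) x x), y ∈ (extChartAt 𝓘(ℝ, E) x).target :=
    extChartAt_target_mem_nhds x
  -- The coordinate expression of F uses the fixed chart at F x, which is differentiable only on its
  -- source.
  have h2 : ∀ᶠ y in 𝓝 (extChartAt 𝓘(ℝ, E) x x),
      F ((extChartAt 𝓘(ℝ, E) x).symm y) ∈ (chartAt E' (F x)).source := by
    have hc : ContinuousAt (fun y => F ((extChartAt 𝓘(ℝ, E) x).symm y))
        (extChartAt 𝓘(ℝ, E) x x) :=
      hF.continuous.continuousAt.comp (continuousAt_extChartAt_symm x)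
    refine hc.eventually_mem ?_
    rw [extChartAt_to_inv]
    exact chart_source_mem_nhds E' (F x)
  filter_upwards [h1, h2] with y hy hy'
  have hs : MDifferentiableAt 𝓘(ℝ, E) 𝓘(ℝ, E) (extChartAt 𝓘(ℝ, E) x).symm y := by
    have := mdifferentiableWithinAt_extChartAt_symm (I := 𝓘(ℝ, E)) hy
    rwa [modelWithCornersSelf_coe, Set.range_id, mdifferentiableWithinAt_univ] at this
  have hFd : MDifferentiableAt 𝓘(ℝ, E) 𝓘(ℝ, E') F ((extChartAt 𝓘(ℝ, E) x).symm y) :=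
    hF.mdifferentiable (by simp) _
  have hN : MDifferentiableAt 𝓘(ℝ, E') 𝓘(ℝ, E') (extChartAt 𝓘(ℝ, E') (F x))
      (F ((extChartAt 𝓘(ℝ, E) x).symm y)) := mdifferentiableAt_extChartAt hy'
  have hcomp : mfderiv 𝓘(ℝ, E) 𝓘(ℝ, E') (writtenInExtChartAt 𝓘(ℝ, E) 𝓘(ℝ, E') x F) y
      = (mfderiv 𝓘(ℝ, E') 𝓘(ℝ, E') (extChartAt 𝓘(ℝ, E') (F x))
          (F ((extChartAt 𝓘(ℝ, E) x).symm y))).comp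
        ((mfderiv 𝓘(ℝ, E) 𝓘(ℝ, E') F ((extChartAt 𝓘(ℝ, E) x).symm y)).comp
          (mfderiv 𝓘(ℝ, E) 𝓘(ℝ, E) (extChartAt 𝓘(ℝ, E) x).symm y)) := by
    rw [← mfderiv_comp y hFd hs]
    exact mfderiv_comp y hN (hFd.comp y hs)
  have hinv : mfderiv 𝓘(ℝ, E) 𝓘(ℝ, E) (extChartAt 𝓘(ℝ, E) x).symm y
      (mpullbackWithin 𝓘(ℝ, E) 𝓘(ℝ, E) (extChartAt 𝓘(ℝ, E) x).symm V
          (Set.range 𝓘(ℝ, E)) y) = V ((extChartAt 𝓘(ℝ, E) x).symm y) := by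
    have h := isInvertible_mfderivWithin_extChartAt_symm (I := 𝓘(ℝ, E)) hy
    rw [mpullbackWithin_apply]
    simp only [modelWithCornersSelf_coe, Set.range_id, mfderivWithin_univ] at h ⊢
    exact h.self_apply_inverse _
  rw [← mfderiv_eq_fderiv, hcomp]
  change mfderiv 𝓘(ℝ, E') 𝓘(ℝ, E') (extChartAt 𝓘(ℝ, E') (F x)) _
    (mfderiv 𝓘(ℝ, E) 𝓘(ℝ, E') F _ (mfderiv 𝓘(ℝ, E) 𝓘(ℝ, E) (extChartAt 𝓘(ℝ, E) x).symm y _)) = 0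
  rw [hinv, hV, map_zero]

/-- The kernel of the differential of a smooth map is involutive. -/
theorem mfderiv_mlieBracket_eq_zero [CompleteSpace E] {F : M → N} (hF : ContMDiff 𝓘(ℝ, E) 𝓘(ℝ, E') ∞ F)
    {V W : ∀ x : M, TangentSpace 𝓘(ℝ, E) x} {x : M}
    (hVd : MDiffAt (T% V) x) (hWd : MDiffAt (T% W) x)
    (hV : ∀ x, mfderiv 𝓘(ℝ, E) 𝓘(ℝ, E') F x (V x) = 0)
    (hW : ∀ x, mfderiv 𝓘(ℝ, E) 𝓘(ℝ, E') F x (W x) = 0) :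
    mfderiv 𝓘(ℝ, E) 𝓘(ℝ, E') F x (mlieBracket 𝓘(ℝ, E) V W x) = 0 := by
  set V' := mpullbackWithin 𝓘(ℝ, E) 𝓘(ℝ, E) (extChartAt 𝓘(ℝ, E) x).symm V
    (Set.range 𝓘(ℝ, E)) with hV'
  set W' := mpullbackWithin 𝓘(ℝ, E) 𝓘(ℝ, E) (extChartAt 𝓘(ℝ, E) x).symm W
    (Set.range 𝓘(ℝ, E)) with hW'
  -- The chart at x has identity derivative at x itself, so no transition map appears there.
  have hb : mlieBracket 𝓘(ℝ, E) V W x = lieBracket ℝ V' W' (extChartAt 𝓘(ℝ, E) x x) := by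
    rw [← mlieBracketWithin_univ, mlieBracketWithin_apply, mfderiv_extChartAt_self]
    simp only [Set.preimage_univ, Set.univ_inter]
    rw [← hV', ← hW', modelWithCornersSelf_coe, Set.range_id]
    exact (congrArg (fun L : E →L[ℝ] E => L _)
      (ContinuousLinearMap.inverse_id (M := E) (R := ℝ))).trans
        (congrFun (lieBracketWithin_univ (𝕜 := ℝ)) _)
  have hFd : mfderiv 𝓘(ℝ, E) 𝓘(ℝ, E') F x
      = fderiv ℝ (writtenInExtChartAt 𝓘(ℝ, E) 𝓘(ℝ, E') x F) (extChartAt 𝓘(ℝ, E) x x) := by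
    rw [(hF.mdifferentiable (by simp) x).mfderiv]
    rw [modelWithCornersSelf_coe, Set.range_id]
    exact congrFun (fderivWithin_univ (𝕜 := ℝ)) _
  have hVd' : DifferentiableAt ℝ V' (extChartAt 𝓘(ℝ, E) x x) := by
    have := MDifferentiableWithinAt.differentiableWithinAt_mpullbackWithin_vectorField
      (mdifferentiableWithinAt_univ.2 hVd)
    rw [Set.preimage_univ, Set.univ_inter] at this
    refine differentiableWithinAt_univ.1 ?_
    rwa [← Set.range_id, ← modelWithCornersSelf_coe ℝ]
  have hWd' : DifferentiableAt ℝ W' (extChartAt 𝓘(ℝ, E) x x) := by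
    have := MDifferentiableWithinAt.differentiableWithinAt_mpullbackWithin_vectorField
      (mdifferentiableWithinAt_univ.2 hWd)
    rw [Set.preimage_univ, Set.univ_inter] at this
    refine differentiableWithinAt_univ.1 ?_
    rwa [← Set.range_id, ← modelWithCornersSelf_coe ℝ]
  have hg : ContDiffAt ℝ ∞ (writtenInExtChartAt 𝓘(ℝ, E) 𝓘(ℝ, E') x F)
      (extChartAt 𝓘(ℝ, E) x x) := by
    have := (contMDiffAt_iff.1 (hF x)).2
    simpa using! this
  -- By symmetry of the second derivative, Df applied to a bracket is the difference of the
  -- derivatives of Df(V') and Df(W') along the other field. Both functions vanish near the point.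
  have key := fderiv_apply_lieBracket hg (by simpa using! (WithTop.coe_le_coe.2 le_top : (2 : ℕ∞ω) ≤ ∞)) hWd' hVd'
  have e1 := eventually_fderiv_writtenInExtChartAt_mpullbackWithin hF hV x
  have e2 := eventually_fderiv_writtenInExtChartAt_mpullbackWithin hF hW x
  have z1 : fderiv ℝ (fun y => fderiv ℝ (writtenInExtChartAt 𝓘(ℝ, E) 𝓘(ℝ, E') x F) y (V' y))
      (extChartAt 𝓘(ℝ, E) x x) = 0 := by
    rw [Filter.EventuallyEq.fderiv_eq (f₁ := _) (f := fun _ => (0 : E')) e1]; simp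
  have z2 : fderiv ℝ (fun y => fderiv ℝ (writtenInExtChartAt 𝓘(ℝ, E) 𝓘(ℝ, E') x F) y (W' y))
      (extChartAt 𝓘(ℝ, E) x x) = 0 := by
    rw [Filter.EventuallyEq.fderiv_eq (f₁ := _) (f := fun _ => (0 : E')) e2]; simp
  rw [z1, z2] at key
  rw [hFd, hb]
  exact key.trans (sub_self (0 : E'))

end Involutive

/-! ### Smooth distributions: orthogonal projection and extension of vectors to sections. -/

section Projection

/-- The determinant of a matrix of smooth functions is smooth. -/
theorem contMDiffAt_det {E : Type*} [NormedAddCommGroup E] [NormedSpace ℝ E]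
    {M : Type*} [TopologicalSpace M] [ChartedSpace E M]
    {n : Type*} [Fintype n] [DecidableEq n] {A : M → Matrix n n ℝ} {x : M}
    (hA : ∀ i j, CMDiffAt ∞ (fun y => A y i j) x) : CMDiffAt ∞ (fun y => (A y).det) x := by
  simp only [Matrix.det_apply']
  refine contMDiffAt_finsetSum fun σ _ => ?_
  exact contMDiffAt_const.mul (contMDiffAt_finsetProd fun i _ => hA _ _)

/-- The orthogonal projection to a span in terms of the Gram matrix. -/
theorem starProjection_span_eq_sum {V : Type*} [NormedAddCommGroup V] [InnerProductSpace ℝ V]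
    [FiniteDimensional ℝ V] {k : ℕ} {X : Fin k → V} (hX : LinearIndependent ℝ X) (v : V) :
    (Submodule.span ℝ (Set.range X)).starProjection v
      = ∑ i, ((Matrix.gram ℝ X).det⁻¹
          * (Matrix.gram ℝ X).cramer (fun j => ⟪X j, v⟫_ℝ) i) • X i := by
  have hdet := Matrix.det_gram_ne_zero_iff_linearIndependent.2 hX
  refine Submodule.eq_starProjection_of_mem_of_inner_eq_zero
    (Submodule.sum_mem _ fun i _ => Submodule.smul_mem _ _ (Submodule.subset_span ⟨i, rfl⟩)) ?_
  have hj : ∀ j, ⟪X j, v - ∑ i, ((Matrix.gram ℝ X).det⁻¹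
          * (Matrix.gram ℝ X).cramer (fun j => ⟪X j, v⟫_ℝ) i) • X i⟫_ℝ = 0 := by
    intro j
    -- Cramer's rule solves the normal equations, which say that the residual is orthogonal to every
    -- X j. The coefficients are then quotients of determinants of inner products, so their
    -- smoothness is visible.
    have h := congrFun (Matrix.mulVec_cramer (Matrix.gram ℝ X) (fun j => ⟪X j, v⟫_ℝ)) j
    simp only [Matrix.mulVec, dotProduct, Matrix.gram_apply, Pi.smul_apply, smul_eq_mul] at h
    rw [inner_sub_right, inner_sum]
    simp only [real_inner_smul_right, mul_assoc]
    rw [← Finset.mul_sum]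
    simp only [mul_comm _ ⟪X j, X _⟫_ℝ]
    rw [h, inv_mul_cancel_left₀ hdet, sub_self]
  intro w hw
  rw [real_inner_comm]
  induction hw using Submodule.span_induction with
  | mem w hw => obtain ⟨j, rfl⟩ := hw; exact hj j
  | zero => simp
  | add a b _ _ ha hb => rw [inner_add_left, ha, hb, add_zero]
  | smul a b _ hb => rw [real_inner_smul_left, hb, mul_zero]

variable {E : Type*} [NormedAddCommGroup E] [NormedSpace ℝ E]
  {M : Type*} [TopologicalSpace M] [ChartedSpace E M] [IsManifold 𝓘(ℝ, E) ∞ M]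

/-- A vector of a smooth distribution extends to a global smooth section. -/
theorem IsSmoothDistribution.exists_isSection [FiniteDimensional ℝ E] [T2Space M]
    {D : ∀ x : M, Submodule ℝ (TangentSpace 𝓘(ℝ, E) x)} (hD : IsSmoothDistribution D)
    {x : M} {v : TangentSpace 𝓘(ℝ, E) x} (hv : v ∈ D x) :
    ∃ V : ∀ x : M, TangentSpace 𝓘(ℝ, E) x, IsSection D V ∧ V x = v := by
  obtain ⟨k, X, hX⟩ := hD x
  obtain ⟨c, hc⟩ : ∃ c : Fin k → ℝ, ∑ i, c i • X i x = v := by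
    rw [← hX.self_of_nhds.2.2] at hv
    exact (Submodule.mem_span_range_iff_exists_fun ℝ).1 hv
  obtain ⟨u, hu, huo, hxu⟩ := mem_nhds_iff.1 hX
  obtain ⟨ψ, -, hψ⟩ :=
    (SmoothBumpFunction.nhds_basis_tsupport (I := 𝓘(ℝ, E)) x).mem_iff.1 (huo.mem_nhds hxu)
  let V : ∀ y : M, TangentSpace 𝓘(ℝ, E) y := fun y => ∑ i, c i • X i y
  have hVs : CMDiff[u] ∞ (T% V) := fun y hy =>
    (ContMDiffAt.sum_section (I := 𝓘(ℝ, E)) (F := E) (V := fun x : M => TangentSpace 𝓘(ℝ, E) x)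
      (t := fun i y => c i • X i y) (s := Finset.univ)
      fun i _ => ((hu hy).1 i).const_smul_section).contMDiffWithinAt
  -- Near x the field has constant coefficients in a local frame; the bump function, equal to 1 at
  -- x, extends it by zero.
  refine ⟨(ψ : M → ℝ) • V,
    ⟨ContMDiffOn.smul_section_of_tsupport ψ.contMDiff.contMDiffOn huo hψ hVs, fun y => ?_⟩, ?_⟩
  · by_cases hy : y ∈ tsupport ψ
    · rw [← (hu (hψ hy)).2.2]
      exact Submodule.smul_mem _ _ (Submodule.sum_mem _ fun i _ => Submodule.smul_mem _ _
        (Submodule.subset_span ⟨i, rfl⟩))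
    · simp [image_eq_zero_of_notMem_tsupport hy]
  · simp [V, hc]

variable [RiemannianBundle (fun x : M => TangentSpace 𝓘(ℝ, E) x)]
  [IsContMDiffRiemannianBundle 𝓘(ℝ, E) ∞ E (fun x : M => TangentSpace 𝓘(ℝ, E) x)]

/-- The orthogonal projection of a smooth vector field to a smooth distribution is smooth. -/
theorem IsSmoothDistribution.contMDiff_starProjection [FiniteDimensional ℝ E]
    {D : ∀ x : M, Submodule ℝ (TangentSpace 𝓘(ℝ, E) x)} (hD : IsSmoothDistribution D)
    {Y : ∀ x : M, TangentSpace 𝓘(ℝ, E) x} (hY : CMDiff ∞ (T% Y)) :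
    CMDiff ∞ (T% (fun x => (D x).starProjection (Y x))) := by
  intro x
  obtain ⟨k, X, hX⟩ := hD x
  have hXx := hX.self_of_nhds.1
  let G : M → Matrix (Fin k) (Fin k) ℝ := fun y => Matrix.gram ℝ fun i => X i y
  let c : Fin k → M → ℝ := fun i y => (G y).det⁻¹ * (G y).cramer (fun j => ⟪X j y, Y y⟫_ℝ) i
  have hG : ∀ i j, CMDiffAt ∞ (fun y => G y i j) x := fun i j =>
    ContMDiffAt.inner_bundle (IB := 𝓘(ℝ, E)) (F := E)
      (E := fun x : M => TangentSpace 𝓘(ℝ, E) x) (b := fun y => y) (hXx i) (hXx j)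
  have hb : ∀ j, CMDiffAt ∞ (fun y => ⟪X j y, Y y⟫_ℝ) x := fun j =>
    ContMDiffAt.inner_bundle (IB := 𝓘(ℝ, E)) (F := E)
      (E := fun x : M => TangentSpace 𝓘(ℝ, E) x) (b := fun y => y) (hXx j) (hY x)
  have hc : ∀ i, CMDiffAt ∞ (c i) x := by
    intro i
    refine ContMDiffAt.mul ?_ ?_
    · exact (contMDiffAt_det hG).inv₀
        (Matrix.det_gram_ne_zero_iff_linearIndependent.2 hX.self_of_nhds.2.1)
    · simp only [Matrix.cramer_apply]
      refine contMDiffAt_det fun a b => ?_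
      -- The i-th Cramer determinant is that of the Gram matrix with column i replaced by the inner
      -- products with Y.
      by_cases h : b = i
      · subst h; simpa using hb a
      · simpa [h] using hG a b
  have hs : CMDiffAt ∞ (T% (fun y => ∑ i, c i y • X i y)) x :=
    ContMDiffAt.sum_section fun i _ => (hc i).smul_section (hXx i)
  refine hs.congr_of_eventuallyEq ?_
  filter_upwards [hX] with y hy
  simp only [Bundle.TotalSpace.mk_inj]
  rw [← starProjection_span_eq_sum hy.2.1]
  simp only [hy.2.2]

end Projection

/-! ### Sasakian geometry on the contact distribution ker η. -/

section SasakianGeometry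

variable {E : Type*} [NormedAddCommGroup E] [NormedSpace ℝ E]
  {M : Type*} [TopologicalSpace M] [ChartedSpace E M] [IsManifold 𝓘(ℝ, E) ∞ M]

theorem contMDiff_mlieBracket [CompleteSpace E] {X Y : ∀ x : M, TangentSpace 𝓘(ℝ, E) x}
    (hX : CMDiff ∞ (T% X)) (hY : CMDiff ∞ (T% Y)) :
    CMDiff ∞ (T% (mlieBracket 𝓘(ℝ, E) X Y)) := by
  have : IsManifold 𝓘(ℝ, E) (minSmoothness ℝ 2) M := IsManifold.of_le (n := ∞) (by
    rw [minSmoothness_of_isRCLikeNormedField]; exact WithTop.coe_le_coe.2 le_top)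
  have : IsManifold 𝓘(ℝ, E) (((⊤ : ℕ∞) : ℕ∞ω) + 1) M := ‹IsManifold 𝓘(ℝ, E) ∞ M›
  exact ContDiff.mlieBracket_vectorField (n := ⊤) (m := ⊤) hX hY (by simp)

theorem mlieBracket_jacobi [CompleteSpace E] {X Y Z : ∀ x : M, TangentSpace 𝓘(ℝ, E) x}
    (hX : CMDiff ∞ (T% X)) (hY : CMDiff ∞ (T% Y)) (hZ : CMDiff ∞ (T% Z)) (x : M) :
    mlieBracket 𝓘(ℝ, E) (mlieBracket 𝓘(ℝ, E) X Y) Z x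
      + mlieBracket 𝓘(ℝ, E) (mlieBracket 𝓘(ℝ, E) Y Z) X x
      + mlieBracket 𝓘(ℝ, E) (mlieBracket 𝓘(ℝ, E) Z X) Y x = 0 := by
  have h2 : minSmoothness ℝ 2 ≤ (∞ : ℕ∞ω) := by
    rw [minSmoothness_of_isRCLikeNormedField]
    exact WithTop.coe_le_coe.2 le_top
  have h3 : minSmoothness ℝ 3 ≤ (∞ : ℕ∞ω) := by
    rw [minSmoothness_of_isRCLikeNormedField]
    exact WithTop.coe_le_coe.2 le_top
  have : IsManifold 𝓘(ℝ, E) (minSmoothness ℝ 3) M := IsManifold.of_le h3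
  have h := leibniz_identity_mlieBracket_apply (x := x) ((hX x).of_le h2) ((hY x).of_le h2)
    ((hZ x).of_le h2)
  rw [mlieBracket_swap_apply (V := X) (W := mlieBracket 𝓘(ℝ, E) Y Z),
    mlieBracket_swap_apply (V := Y) (W := mlieBracket 𝓘(ℝ, E) X Z),
    mlieBracket_swap (V := X) (W := Z)] at h
  have hn : mlieBracket 𝓘(ℝ, E) (-mlieBracket 𝓘(ℝ, E) Z X) Y x
      = -mlieBracket 𝓘(ℝ, E) (mlieBracket 𝓘(ℝ, E) Z X) Y x := by
    have := mlieBracket_const_smul_left (c := (-1 : ℝ)) (W := Y)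
      ((contMDiff_mlieBracket hZ hX).mdifferentiable (by simp) x)
    simpa using this
  rw [hn, neg_neg] at h
  rw [add_right_comm, ← h]
  exact neg_add_cancel _

variable [RiemannianBundle (fun x : M => TangentSpace 𝓘(ℝ, E) x)]

namespace AlmostContactMetric

variable (S : AlmostContactMetric E M)

/-- Metric compatibility with second argument ξ, where φξ = 0. It lets horizontality of ξ be read as
vanishing of η on vertical vectors. -/
theorem η_eq_inner (x : M) (v : TangentSpace 𝓘(ℝ, E) x) : S.η x v = ⟪v, S.ξ x⟫_ℝ := by
  have h := S.inner_φ_φ x v (S.ξ x)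
  rw [S.φ_ξ, inner_zero_right, S.η_ξ] at h
  linarith

theorem inner_φ_left (x : M) (v w : TangentSpace 𝓘(ℝ, E) x) :
    ⟪S.φ x v, w⟫_ℝ = -⟪v, S.φ x w⟫_ℝ := by
  have h := S.inner_φ_φ x v (S.φ x w)
  rw [S.η_φ, S.φ_φ, inner_add_right, inner_neg_right, real_inner_smul_right, ← S.η_eq_inner,
    S.η_φ] at h
  linarith

theorem norm_φ {x : M} {v : TangentSpace 𝓘(ℝ, E) x} (hv : S.η x v = 0) : ‖S.φ x v‖ = ‖v‖ := by
  have h := S.inner_φ_φ x v v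
  rw [hv, real_inner_self_eq_norm_sq, real_inner_self_eq_norm_sq] at h
  exact (sq_eq_sq₀ (norm_nonneg _) (norm_nonneg _)).1 (by linarith)

theorem contMDiff_phi {X : ∀ x : M, TangentSpace 𝓘(ℝ, E) x} (hX : CMDiff ∞ (T% X)) :
    CMDiff ∞ (T% (S.phi X)) :=
  ContMDiff.clm_bundle_apply (F₁ := E) (F₂ := E)
    (E₁ := fun x : M => TangentSpace 𝓘(ℝ, E) x) (E₂ := fun x : M => TangentSpace 𝓘(ℝ, E) x)
    (b := fun x => x) S.smooth_φ hX

variable {S} {X Y Z : ∀ x : M, TangentSpace 𝓘(ℝ, E) x}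

/-- On the contact distribution, `2 g(X, φY) = -η([X, Y])`. -/
theorem IsSasakian.η_mlieBracket (hS : S.IsSasakian) (hX : CMDiff ∞ (T% X))
    (hY : CMDiff ∞ (T% Y)) (hX0 : ∀ x, S.η x (X x) = 0) (hY0 : ∀ x, S.η x (Y x) = 0) (x : M) :
    S.η x (mlieBracket 𝓘(ℝ, E) X Y x) = -2 * ⟪X x, S.phi Y x⟫_ℝ := by
  rw [phi, hS.contact X Y hX hY, dη]
  simp only [hX0, hY0, mvfderiv_const]
  simp

/-- Normality, on the contact distribution. -/
theorem IsSasakian.inner_nijenhuis (hS : S.IsSasakian) (hY : CMDiff ∞ (T% Y))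
    (hZ : CMDiff ∞ (T% Z)) (hX0 : ∀ x, S.η x (X x) = 0) (x : M) :
    ⟪mlieBracket 𝓘(ℝ, E) (S.phi Y) (S.phi Z) x, S.phi X x⟫_ℝ
      - ⟪mlieBracket 𝓘(ℝ, E) Y Z x, S.phi X x⟫_ℝ
      - ⟪mlieBracket 𝓘(ℝ, E) (S.phi Y) Z x, X x⟫_ℝ
      - ⟪mlieBracket 𝓘(ℝ, E) Y (S.phi Z) x, X x⟫_ℝ = 0 := by
  -- Pairing with φX removes the ξ-term, and g(φA, φX) = g(A, X) because η(X) = 0.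
  have h := congrArg (fun v => ⟪v, S.φ x (X x)⟫_ℝ) (hS.normal Y Z hY hZ x)
  have hξ : ⟪S.ξ x, S.φ x (X x)⟫_ℝ = 0 := by rw [real_inner_comm, ← S.η_eq_inner, S.η_φ]
  simp only [nijenhuis, inner_add_left, inner_sub_left, real_inner_smul_left, S.inner_φ_φ, hX0,
    S.φ_φ, inner_neg_left, hξ, inner_zero_left] at h
  simp only [phi] at h ⊢
  linarith

variable [IsContMDiffRiemannianBundle 𝓘(ℝ, E) ∞ E (fun x : M => TangentSpace 𝓘(ℝ, E) x)]
  [CompleteSpace E]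

/-- For `X` in the contact distribution,
`2 g([Y, Z], φX) = 2 X g(Y, φZ) - η([[Y, Z], X])`. -/
theorem IsSasakian.inner_mlieBracket_phi (hS : S.IsSasakian) (hX : CMDiff ∞ (T% X))
    (hY : CMDiff ∞ (T% Y)) (hZ : CMDiff ∞ (T% Z)) (hX0 : ∀ x, S.η x (X x) = 0)
    (hY0 : ∀ x, S.η x (Y x) = 0) (hZ0 : ∀ x, S.η x (Z x) = 0) (x : M) :
    2 * ⟪mlieBracket 𝓘(ℝ, E) Y Z x, S.phi X x⟫_ℝ = 2 * dInner X Y (S.phi Z) x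
      - S.η x (mlieBracket 𝓘(ℝ, E) (mlieBracket 𝓘(ℝ, E) Y Z) X x) := by
  have hd := mdifferentiableAt_inner (hY.mdifferentiable (by simp) x)
    ((S.contMDiff_phi hZ).mdifferentiable (by simp) x)
  -- The contact condition for the pair ([Y, Z], X): η(X) = 0 kills one derivative term, and the
  -- other contains η([Y, Z]) = -2 g(Y, φZ).
  rw [phi, hS.contact _ X (contMDiff_mlieBracket hY hZ) hX, dη]
  simp only [hX0, mvfderiv_const, hS.η_mlieBracket hY hZ hY0 hZ0]
  rw [mvfderiv_fun_mul (mdifferentiableAt_const (c := (-2 : ℝ))) hd, mvfderiv_const, dInner]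
  simp

/-- The fundamental form of a Sasakian manifold is closed, on the contact distribution. -/
theorem IsSasakian.dΦ_eq_zero (hS : S.IsSasakian) (hX : CMDiff ∞ (T% X))
    (hY : CMDiff ∞ (T% Y)) (hZ : CMDiff ∞ (T% Z)) (hX0 : ∀ x, S.η x (X x) = 0)
    (hY0 : ∀ x, S.η x (Y x) = 0) (hZ0 : ∀ x, S.η x (Z x) = 0) (x : M) :
    dInner X Y (S.phi Z) x + dInner Y Z (S.phi X) x + dInner Z X (S.phi Y) x
      - ⟪mlieBracket 𝓘(ℝ, E) X Y x, S.phi Z x⟫_ℝ - ⟪mlieBracket 𝓘(ℝ, E) Y Z x, S.phi X x⟫_ℝ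
      - ⟪mlieBracket 𝓘(ℝ, E) Z X x, S.phi Y x⟫_ℝ = 0 := by
  have h1 := hS.inner_mlieBracket_phi hX hY hZ hX0 hY0 hZ0 x
  have h2 := hS.inner_mlieBracket_phi hY hZ hX hY0 hZ0 hX0 x
  have h3 := hS.inner_mlieBracket_phi hZ hX hY hZ0 hX0 hY0 x
  -- This is d²η = 0: in the cyclic sum the double brackets cancel by Jacobi.
  have hJ := congrArg (S.η x) (mlieBracket_jacobi hX hY hZ x)
  simp only [map_add, map_zero] at hJ
  linarith

/-- `(∇_X φ)Y` has no component in the contact distribution, for `X` and `Y` in the contact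
distribution. -/
theorem IsSasakian.inner_nabla_phi {E : Type*} [NormedAddCommGroup E] [NormedSpace ℝ E]
    [FiniteDimensional ℝ E] {M : Type*} [TopologicalSpace M] [ChartedSpace E M]
    [IsManifold 𝓘(ℝ, E) ∞ M] [RiemannianBundle (fun x : M => TangentSpace 𝓘(ℝ, E) x)]
    [IsContMDiffRiemannianBundle 𝓘(ℝ, E) ∞ E (fun x : M => TangentSpace 𝓘(ℝ, E) x)]
    {S : AlmostContactMetric E M} {X Y Z : ∀ x : M, TangentSpace 𝓘(ℝ, E) x}
    (hS : S.IsSasakian) (hX : CMDiff ∞ (T% X))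
    (hY : CMDiff ∞ (T% Y)) (hZ : CMDiff ∞ (T% Z)) (hX0 : ∀ x, S.η x (X x) = 0)
    (hY0 : ∀ x, S.η x (Y x) = 0) (hZ0 : ∀ x, S.η x (Z x) = 0) (x : M) :
    ⟪nabla X (S.phi Y) x, Z x⟫_ℝ = ⟪S.φ x (nabla X Y x), Z x⟫_ℝ := by
  have : CompleteSpace E := FiniteDimensional.complete ℝ E
  have hφY := S.contMDiff_phi hY
  have hφZ := S.contMDiff_phi hZ
  have hd : ∀ {V : ∀ x : M, TangentSpace 𝓘(ℝ, E) x}, CMDiff ∞ (T% V) → MDiffAt (T% V) x :=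
    fun h => h.mdifferentiable (by simp) x
  have hηφ : ∀ V : ∀ x : M, TangentSpace 𝓘(ℝ, E) x, ∀ x, S.η x (S.phi V x) = 0 :=
    fun V x => S.η_φ x (V x)
  have hφφ : ∀ {V : ∀ x : M, TangentSpace 𝓘(ℝ, E) x}, (∀ x, S.η x (V x) = 0) →
      S.phi (S.phi V) = fun x => -V x := fun h => by
    funext y
    simp only [phi, S.φ_φ, h, zero_smul, add_zero]
  have k1 := inner_leviCivitaFun (hd hX) (hd hφY) (hd hZ)
  have k2 := inner_leviCivitaFun (hd hX) (hd hY) (hd hφZ)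
  have d1 := hS.dΦ_eq_zero hX hY hZ hX0 hY0 hZ0 x
  -- The classical combination: once φ² = -1 on ker η and skewness of φ are used, the sum of the
  -- Koszul expressions in `k1` and `k2` equals `d2 - d1 + n`, hence vanishes.
  have d2 := hS.dΦ_eq_zero hX hφY hφZ hX0 (hηφ Y) (hηφ Z) x
  have n := hS.inner_nijenhuis (X := X) hY hZ hX0 x
  rw [S.inner_φ_left]
  change ⟪leviCivitaFun (S.phi Y) x (X x), Z x⟫_ℝ = -⟪leviCivitaFun Y x (X x), S.phi Z x⟫_ℝ
  have hneg : ∀ A B C : ∀ x : M, TangentSpace 𝓘(ℝ, E) x,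
      dInner A B (fun x => -C x) x = -dInner A B C x := by
    intro A B C
    simp only [dInner, inner_neg_right]
    rw [mvfderiv_fun_neg]; rfl
  have hskew : ∀ A B C : ∀ x : M, TangentSpace 𝓘(ℝ, E) x,
      dInner A (S.phi B) C x = -dInner A B (S.phi C) x := by
    intro A B C
    simp only [dInner, phi, S.inner_φ_left]
    rw [mvfderiv_fun_neg]; rfl
  have hinv : ∀ A B C : ∀ x : M, TangentSpace 𝓘(ℝ, E) x, (∀ x, S.η x (B x) = 0) →
      dInner A (S.phi B) (S.phi C) x = dInner A B C x := by
    intro A B C hB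
    simp only [dInner, phi, S.inner_φ_φ, hB, zero_mul, sub_zero]
  rw [hφφ hY0, hφφ hZ0] at d2
  rw [hneg, hneg, hinv _ _ _ hZ0] at d2
  simp only [inner_neg_right] at d2
  simp only [koszul] at k1 k2
  have s1 := hskew X Y Z
  have s2 := hskew Y Z X
  linarith

end AlmostContactMetric

end SasakianGeometry

/-! ### Linear algebra of the slant condition. -/

section SlantAlgebra

variable {V : Type*} [NormedAddCommGroup V] [InnerProductSpace ℝ V]

/-- If a skew isometry `A` makes the constant angle `θ` with the subspace `D`, then the compression
`P` of `A` to `D` satisfies `P² = -cos² θ`. -/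
theorem starProjection_starProjection_eq_of_angle_eq {D : Submodule ℝ V}
    [D.HasOrthogonalProjection] {A : V →L[ℝ] V} {θ : ℝ} (hskew : ∀ v w, ⟪A v, w⟫_ℝ = -⟪v, A w⟫_ℝ)
    (hnorm : ∀ v ∈ D, ‖A v‖ = ‖v‖)
    (hangle : ∀ v ∈ D, v ≠ 0 → InnerProductGeometry.angle (A v) (D.starProjection (A v)) = θ)
    {v : V} (hv : v ∈ D) :
    D.starProjection (A (D.starProjection (A v))) = (-(Real.cos θ) ^ 2) • v := by
  have hP : ∀ u, ∀ w ∈ D, ⟪D.starProjection u, w⟫_ℝ = ⟪u, w⟫_ℝ := fun u w hw => by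
    rw [Submodule.inner_starProjection_left_eq_right, Submodule.starProjection_eq_self_iff.2 hw]
  have hB : ∀ v ∈ D, ‖D.starProjection (A v)‖ ^ 2 = Real.cos θ ^ 2 * ‖v‖ ^ 2 := by
    intro v hv
    rcases eq_or_ne v 0 with rfl | hv0
    · simp
    have hθ := hangle v hv hv0
    have h := InnerProductGeometry.cos_angle_mul_norm_mul_norm (A v) (D.starProjection (A v))
    rw [hθ, hnorm v hv, ← hP _ _ (D.starProjection_apply_mem _), real_inner_self_eq_norm_sq] at h
    -- If the projection vanishes, the angle is π/2 by convention, so cos θ = 0 and the formula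
    -- still holds.
    rcases eq_or_ne (D.starProjection (A v)) 0 with h0 | h0
    · rw [h0, InnerProductGeometry.angle_zero_right] at hθ
      rw [h0, ← hθ]
      simp
    · have h0' : ‖D.starProjection (A v)‖ ≠ 0 := norm_ne_zero_iff.2 h0
      have : Real.cos θ * ‖v‖ = ‖D.starProjection (A v)‖ :=
        mul_right_cancel₀ h0' (by linear_combination h)
      rw [← this]
      ring
  -- Polarization: on D the compression P multiplies all inner products by cos²θ. As P is also skew
  -- on D, P² = -cos²θ follows.
  have hpol : ∀ v ∈ D, ∀ w ∈ D,
      ⟪D.starProjection (A v), D.starProjection (A w)⟫_ℝ = Real.cos θ ^ 2 * ⟪v, w⟫_ℝ := by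
    intro v hv w hw
    have h := hB _ (D.add_mem hv hw)
    rw [map_add, map_add, norm_add_sq_real, norm_add_sq_real, hB v hv, hB w hw] at h
    linarith
  have hz : ∀ w ∈ D, ⟪D.starProjection (A (D.starProjection (A v)))
      - (-(Real.cos θ) ^ 2) • v, w⟫_ℝ = 0 := by
    intro w hw
    rw [inner_sub_left, hP _ _ hw, hskew, real_inner_comm,
      ← hP (A w) _ (D.starProjection_apply_mem _), real_inner_comm, hpol v hv w hw,
      real_inner_smul_left]
    ring
  have hmem : D.starProjection (A (D.starProjection (A v))) - (-(Real.cos θ) ^ 2) • v ∈ D :=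
    D.sub_mem (D.starProjection_apply_mem _) (D.smul_mem _ hv)
  exact sub_eq_zero.1 (inner_self_eq_zero.1 (hz _ hmem))

end SlantAlgebra

/-! ### Vertical and horizontal parts, and the integrability criterion. -/

section BiSlantSubmersion

variable {E : Type*} [NormedAddCommGroup E] [NormedSpace ℝ E] [FiniteDimensional ℝ E]
  {M : Type*} [TopologicalSpace M] [ChartedSpace E M]
  [RiemannianBundle (fun x : M => TangentSpace 𝓘(ℝ, E) x)]
  {E' : Type*} [NormedAddCommGroup E'] [NormedSpace ℝ E']
  {N : Type*} [TopologicalSpace N] [ChartedSpace E' N]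
  {F : M → N} {X Y : ∀ x : M, TangentSpace 𝓘(ℝ, E) x} {x : M}

theorem verPart_add_horPart (X : ∀ x : M, TangentSpace 𝓘(ℝ, E) x) :
    verPart E' F X + horPart E' F X = X := by
  funext x
  exact Submodule.starProjection_add_starProjection_orthogonal _

theorem verPart_eq_self (hX : ∀ x, X x ∈ vertical E' F x) : verPart E' F X = X := by
  funext x
  exact Submodule.starProjection_eq_self_iff.2 (hX x)

theorem horPart_eq_self (hX : ∀ x, X x ∈ (vertical E' F x)ᗮ) : horPart E' F X = X := by
  funext x
  exact Submodule.starProjection_eq_self_iff.2 (hX x)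

theorem verPart_eq_zero (hX : ∀ x, X x ∈ (vertical E' F x)ᗮ) : verPart E' F X = 0 := by
  funext x
  exact (Submodule.starProjection_apply_eq_zero_iff _).2 (hX x)

theorem inner_verPart {w : TangentSpace 𝓘(ℝ, E) x} (hw : w ∈ vertical E' F x) :
    ⟪verPart E' F X x, w⟫_ℝ = ⟪X x, w⟫_ℝ := by
  rw [verPart, Submodule.inner_starProjection_left_eq_right,
    Submodule.starProjection_eq_self_iff.2 hw]

theorem inner_horPart {w : TangentSpace 𝓘(ℝ, E) x} (hw : w ∈ (vertical E' F x)ᗮ) :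
    ⟪horPart E' F X x, w⟫_ℝ = ⟪X x, w⟫_ℝ := by
  rw [horPart, Submodule.inner_starProjection_left_eq_right,
    Submodule.starProjection_eq_self_iff.2 hw]

variable [IsManifold 𝓘(ℝ, E) ∞ M]

theorem omega_mem (S : AlmostContactMetric E M) :
    omega E' S F X x ∈ (vertical E' F x)ᗮ :=
  Submodule.starProjection_apply_mem _ _

theorem phiHat_mem (S : AlmostContactMetric E M) : phiHat E' S F X x ∈ vertical E' F x :=
  Submodule.starProjection_apply_mem _ _

theorem phiHat_add_omega (S : AlmostContactMetric E M) :
    phiHat E' S F X + omega E' S F X = S.phi X :=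
  verPart_add_horPart _

section Connection

variable [IsContMDiffRiemannianBundle 𝓘(ℝ, E) ∞ E (fun x : M => TangentSpace 𝓘(ℝ, E) x)]

theorem nabla_add {U : ∀ x : M, TangentSpace 𝓘(ℝ, E) x} (hX : MDiffAt (T% X) x)
    (hY : MDiffAt (T% Y) x) : nabla U (X + Y) x = nabla U X x + nabla U Y x := by
  have h := (leviCivita E M).isCovariantDerivativeOnUniv.add hX hY
  exact congrArg (fun L => L (U x)) h

theorem nabla_const_smul {U : ∀ x : M, TangentSpace 𝓘(ℝ, E) x} (a : ℝ)
    (hX : MDiffAt (T% X) x) : nabla U (a • X) x = a • nabla U X x := by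
  have h := (leviCivita E M).isCovariantDerivativeOnUniv.smul_const a hX
  exact congrArg (fun L => L (U x)) h

/-- `T_U Y = 𝓥 ∇_U Y` for vertical `U` and horizontal `Y`, tested against a vertical vector. -/
theorem inner_oneillT_of_horizontal {U : ∀ x : M, TangentSpace 𝓘(ℝ, E) x}
    (hU : ∀ x, U x ∈ vertical E' F x) (hY : ∀ x, Y x ∈ (vertical E' F x)ᗮ)
    {w : TangentSpace 𝓘(ℝ, E) x} (hw : w ∈ vertical E' F x) :
    ⟪oneillT E' F U Y x, w⟫_ℝ = ⟪nabla U Y x, w⟫_ℝ := by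
  rw [oneillT, verPart_eq_self hU, verPart_eq_zero hY, horPart_eq_self hY, Pi.add_apply,
    inner_add_left, inner_verPart hw]
  have h0 : horPart E' F (nabla U 0) x = 0 := by
    have : nabla U (0 : ∀ x : M, TangentSpace 𝓘(ℝ, E) x) x = 0 := by
      simp [nabla]
    rw [horPart, this, map_zero]
  rw [h0, inner_zero_left, zero_add]

end Connection

namespace IsBiSlantSubmersion

variable [RiemannianBundle (fun y : N => TangentSpace 𝓘(ℝ, E') y)]
  {S : AlmostContactMetric E M} {D₁ D₂ : ∀ x : M, Submodule ℝ (TangentSpace 𝓘(ℝ, E) x)}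
  {θ₁ θ₂ : ℝ}

/-- The hypotheses are symmetric in the two distributions, so the criterion for D₂ is the one for D₁
with the roles exchanged. -/
theorem swap (h : IsBiSlantSubmersion E' S F D₁ D₂ θ₁ θ₂) :
    IsBiSlantSubmersion E' S F D₂ D₁ θ₂ θ₁ where
  riemannian := h.riemannian
  reeb_horizontal := h.reeb_horizontal
  smooth₁ := h.smooth₂
  smooth₂ := h.smooth₁
  sup_eq x := by rw [sup_comm, h.sup_eq]
  orthogonal x := (h.orthogonal x).symm
  slant₁ := h.slant₂
  slant₂ := h.slant₁
  φ_orthogonal₁ := h.φ_orthogonal₂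
  φ_orthogonal₂ := h.φ_orthogonal₁

theorem le_vertical (h : IsBiSlantSubmersion E' S F D₁ D₂ θ₁ θ₂) (x : M) :
    D₁ x ≤ vertical E' F x :=
  h.sup_eq x ▸ le_sup_left

theorem η_eq_zero (h : IsBiSlantSubmersion E' S F D₁ D₂ θ₁ θ₂) {x : M}
    {v : TangentSpace 𝓘(ℝ, E) x} (hv : v ∈ vertical E' F x) : S.η x v = 0 := by
  rw [S.η_eq_inner]
  exact h.reeb_horizontal x v hv

/-- A vertical vector which is orthogonal to `D₂` lies in `D₁`. -/
theorem mem_of_inner_eq_zero (h : IsBiSlantSubmersion E' S F D₁ D₂ θ₁ θ₂) {x : M}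
    {v : TangentSpace 𝓘(ℝ, E) x} (hv : v ∈ vertical E' F x) (hv' : ∀ w ∈ D₂ x, ⟪v, w⟫_ℝ = 0) :
    v ∈ D₁ x := by
  rw [← h.sup_eq] at hv
  obtain ⟨a, ha, b, hb, rfl⟩ := Submodule.mem_sup.1 hv
  have hb0 := hv' b hb
  rw [inner_add_left, (h.orthogonal x).inner_eq ha hb, zero_add, inner_self_eq_zero] at hb0
  rwa [hb0, add_zero]

theorem phiHat_mem_left (h : IsBiSlantSubmersion E' S F D₁ D₂ θ₁ θ₂)
    {U : ∀ x : M, TangentSpace 𝓘(ℝ, E) x}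
    {x : M} (hU : U x ∈ D₁ x) : phiHat E' S F U x ∈ D₁ x := by
  refine h.mem_of_inner_eq_zero (phiHat_mem S) fun w hw => ?_
  rw [phiHat, inner_verPart (h.swap.le_vertical x hw)]
  exact h.φ_orthogonal₁ x _ hU w hw

/-- φD₁ ⟂ D₂ means that projecting to all of ker F_* loses nothing against projecting to D₁. This
links φ̂ with the slant angle, which is measured against D₁ alone. -/
theorem phiHat_eq_starProjection (h : IsBiSlantSubmersion E' S F D₁ D₂ θ₁ θ₂)
    {U : ∀ x : M, TangentSpace 𝓘(ℝ, E) x} {x : M} (hU : U x ∈ D₁ x) :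
    phiHat E' S F U x = (D₁ x).starProjection (S.φ x (U x)) := by
  refine (Submodule.eq_starProjection_of_mem_of_inner_eq_zero (h.phiHat_mem_left hU)
    fun w hw => ?_).symm
  rw [inner_sub_left, phiHat, inner_verPart (h.le_vertical x hw)]
  exact sub_self _

theorem phiHat_phiHat (h : IsBiSlantSubmersion E' S F D₁ D₂ θ₁ θ₂)
    {U : ∀ x : M, TangentSpace 𝓘(ℝ, E) x} (hU : ∀ x, U x ∈ D₁ x) :
    phiHat E' S F (phiHat E' S F U) = (-(Real.cos θ₁) ^ 2) • U := by
  funext x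
  rw [h.phiHat_eq_starProjection (h.phiHat_mem_left (hU x)), h.phiHat_eq_starProjection (hU x)]
  exact starProjection_starProjection_eq_of_angle_eq (S.inner_φ_left x)
    (fun v hv => S.norm_φ (h.η_eq_zero (h.le_vertical x hv))) (h.slant₁ x) (hU x)

theorem mlieBracket_mem_vertical [IsManifold 𝓘(ℝ, E') ∞ N]
    (h : IsBiSlantSubmersion E' S F D₁ D₂ θ₁ θ₂)
    {U V : ∀ x : M, TangentSpace 𝓘(ℝ, E) x} (hU : IsSection D₁ U) (hV : IsSection D₁ V) (x : M) :
    mlieBracket 𝓘(ℝ, E) U V x ∈ vertical E' F x := by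
  have : CompleteSpace E := FiniteDimensional.complete ℝ E
  exact mfderiv_mlieBracket_eq_zero h.riemannian.smooth
    (hU.1.mdifferentiable (by simp) x) (hV.1.mdifferentiable (by simp) x)
    (fun y => h.le_vertical y (hU.2 y)) (fun y => h.le_vertical y (hV.2 y))

variable [IsContMDiffRiemannianBundle 𝓘(ℝ, E) ∞ E (fun x : M => TangentSpace 𝓘(ℝ, E) x)]

theorem isSection_phiHat (h : IsBiSlantSubmersion E' S F D₁ D₂ θ₁ θ₂)
    {U : ∀ x : M, TangentSpace 𝓘(ℝ, E) x} (hU : IsSection D₁ U) :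
    IsSection D₁ (phiHat E' S F U) := by
  refine ⟨?_, fun x => h.phiHat_mem_left (hU.2 x)⟩
  have he : phiHat E' S F U = fun x => (D₁ x).starProjection (S.phi U x) :=
    funext fun x => h.phiHat_eq_starProjection (hU.2 x)
  rw [he]
  exact h.smooth₁.contMDiff_starProjection (S.contMDiff_phi hU.1)

/-- Since ωU = φU - φ̂U, smoothness of the projection to D₁ suffices. -/
theorem contMDiff_omega (h : IsBiSlantSubmersion E' S F D₁ D₂ θ₁ θ₂)
    {U : ∀ x : M, TangentSpace 𝓘(ℝ, E) x} (hU : IsSection D₁ U) :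
    CMDiff ∞ (T% (omega E' S F U)) := by
  rw [← add_sub_cancel_left (phiHat E' S F U) (omega E' S F U), phiHat_add_omega]
  exact (S.contMDiff_phi hU.1).sub_section (h.isSection_phiHat hU).1

/-- The `D₂`-component of `∇_U V` for sections `U`, `V` of `D₁`. -/
theorem inner_nabla (h : IsBiSlantSubmersion E' S F D₁ D₂ θ₁ θ₂) (hS : S.IsSasakian)
    {U V W : ∀ x : M, TangentSpace 𝓘(ℝ, E) x} (hU : IsSection D₁ U) (hV : IsSection D₁ V)
    (hW : IsSection D₂ W) (x : M) :
    Real.sin θ₁ ^ 2 * ⟪nabla U V x, W x⟫_ℝ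
      = -⟪oneillT E' F U (omega E' S F (phiHat E' S F V)) x, W x⟫_ℝ
        + ⟪oneillT E' F U (omega E' S F V) x, phiHat E' S F W x⟫_ℝ
        + ⟪horNabla E' F U (omega E' S F V) x, omega E' S F W x⟫_ℝ := by
  have hUv := fun x => h.le_vertical x (hU.2 x)
  have hVv := fun x => h.le_vertical x (hV.2 x)
  have hWv := fun x => h.swap.le_vertical x (hW.2 x)
  have hP := h.isSection_phiHat hV
  have hPv := fun x => h.le_vertical x (hP.2 x)
  have hd : ∀ {V : ∀ x : M, TangentSpace 𝓘(ℝ, E) x}, CMDiff ∞ (T% V) → MDiffAt (T% V) x :=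
    fun h => h.mdifferentiable (by simp) x
  -- The last two terms are the vertical and horizontal halves of g(∇_U ωV, φW) and are merged here.
  rw [inner_oneillT_of_horizontal hUv (fun _ => omega_mem S) (hWv x),
    inner_oneillT_of_horizontal hUv (fun _ => omega_mem S) (phiHat_mem S), horNabla,
    inner_horPart (omega_mem S), add_assoc, ← inner_add_right, ← Pi.add_apply (phiHat E' S F W),
    phiHat_add_omega]
  -- φW is an admissible test field because η ∘ φ = 0; it does not see the ξ-component of (∇_U φ)V.
  have h1 : ⟪nabla U V x, W x⟫_ℝ = ⟪nabla U (S.phi V) x, S.phi W x⟫_ℝ := by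
    rw [hS.inner_nabla_phi hU.1 hV.1 (S.contMDiff_phi hW.1) (fun x => h.η_eq_zero (hUv x))
      (fun x => h.η_eq_zero (hVv x)) (fun x => S.η_φ x _), AlmostContactMetric.phi, S.inner_φ_φ,
      h.η_eq_zero (hWv x), mul_zero, sub_zero]
  have h2 : nabla U (S.phi V) x = nabla U (phiHat E' S F V) x + nabla U (omega E' S F V) x := by
    rw [← nabla_add (hd hP.1) (hd (h.contMDiff_omega hV)), phiHat_add_omega]
  have h3 : ⟪nabla U (phiHat E' S F V) x, S.phi W x⟫_ℝ
      = -⟪nabla U (S.phi (phiHat E' S F V)) x, W x⟫_ℝ := by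
    rw [hS.inner_nabla_phi hU.1 hP.1 hW.1 (fun x => h.η_eq_zero (hUv x))
      (fun x => h.η_eq_zero (hPv x)) (fun x => h.η_eq_zero (hWv x)), S.inner_φ_left, neg_neg]
    rfl
  -- Constancy of the slant angle enters here: cos²θ₁ passes through ∇_U without a derivative term.
  have h4 : nabla U (S.phi (phiHat E' S F V)) x = (-(Real.cos θ₁) ^ 2) • nabla U V x
      + nabla U (omega E' S F (phiHat E' S F V)) x := by
    rw [← nabla_const_smul _ (hd hV.1), ← h.phiHat_phiHat hV.2,
      ← nabla_add (hd (h.isSection_phiHat hP).1) (hd (h.contMDiff_omega hP)), phiHat_add_omega]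
  rw [h2, inner_add_left, h3, h4, inner_add_left, real_inner_smul_left] at h1
  rw [Real.sin_sq]
  linarith

/-- The torsion-free antisymmetrization of `inner_nabla`: the defect of the integrability equation
is the D₂-component of the bracket, scaled by sin²θ₁. -/
theorem inner_mlieBracket (h : IsBiSlantSubmersion E' S F D₁ D₂ θ₁ θ₂) (hS : S.IsSasakian)
    {U V W : ∀ x : M, TangentSpace 𝓘(ℝ, E) x} (hU : IsSection D₁ U) (hV : IsSection D₁ V)
    (hW : IsSection D₂ W) (x : M) :
    Real.sin θ₁ ^ 2 * ⟪mlieBracket 𝓘(ℝ, E) U V x, W x⟫_ℝ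
      = ⟪oneillT E' F U (omega E' S F V) x - oneillT E' F V (omega E' S F U) x,
          phiHat E' S F W x⟫_ℝ
        + ⟪horNabla E' F U (omega E' S F V) x - horNabla E' F V (omega E' S F U) x,
          omega E' S F W x⟫_ℝ
        - ⟪oneillT E' F U (omega E' S F (phiHat E' S F V)) x
          - oneillT E' F V (omega E' S F (phiHat E' S F U)) x, W x⟫_ℝ := by
  have ht := leviCivita_torsion_free (hU.1.mdifferentiable (by simp) x)
    (hV.1.mdifferentiable (by simp) x)
  have h1 := h.inner_nabla hS hU hV hW x
  have h2 := h.inner_nabla hS hV hU hW x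
  rw [← ht]
  change Real.sin θ₁ ^ 2 * ⟪nabla U V x - nabla V U x, W x⟫_ℝ = _
  simp only [inner_sub_left]
  linarith

/-- A `φ`-invariant slant distribution of a bi-slant `ξᗮ`-submersion has no nonzero sections: for a
section `U`, the field `[U, φU]` is vertical, while its `ξ`-component is `2 |U|²`. -/
theorem eq_zero_of_sin_eq_zero [IsManifold 𝓘(ℝ, E') ∞ N]
    (h : IsBiSlantSubmersion E' S F D₁ D₂ θ₁ θ₂) (hS : S.IsSasakian)
    (hθ : Real.sin θ₁ = 0) {U : ∀ x : M, TangentSpace 𝓘(ℝ, E) x} (hU : IsSection D₁ U) :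
    U = 0 := by
  funext x
  have hP := h.isSection_phiHat hU
  have hη : ∀ {V : ∀ x : M, TangentSpace 𝓘(ℝ, E) x}, IsSection D₁ V → ∀ x, S.η x (V x) = 0 :=
    fun hV x => h.η_eq_zero (h.le_vertical x (hV.2 x))
  have h1 := hS.η_mlieBracket hU.1 hP.1 (hη hU) (hη hP) x
  have hc : (Real.cos θ₁) ^ 2 = 1 := by rw [Real.cos_sq', hθ]; simp
  -- φ̂U stands in for φU: it is already known to be a section of D₁, and φ̂² = -1 when cos²θ₁ = 1.
  have h2 : ⟪U x, S.phi (phiHat E' S F U) x⟫_ℝ = -⟪U x, U x⟫_ℝ := by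
    rw [real_inner_comm, ← inner_verPart (E' := E') (F := F) (h.le_vertical x (hU.2 x))]
    change ⟪phiHat E' S F (phiHat E' S F U) x, U x⟫_ℝ = _
    rw [h.phiHat_phiHat hU.2, hc]
    simp
  rw [h.η_eq_zero (h.mlieBracket_mem_vertical hU hP x), h2] at h1
  have h3 : ⟪U x, U x⟫_ℝ = 0 := by linarith
  exact inner_self_eq_zero.1 h3

theorem isIntegrable_left_iff [T2Space M] [IsManifold 𝓘(ℝ, E') ∞ N]
    (h : IsBiSlantSubmersion E' S F D₁ D₂ θ₁ θ₂)
    (hS : S.IsSasakian) :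
    IsIntegrable D₁ ↔
      ∀ U V W : ∀ x : M, TangentSpace 𝓘(ℝ, E) x,
        IsSection D₁ U → IsSection D₁ V → IsSection D₂ W → ∀ x : M,
          ⟪oneillT E' F U (omega E' S F (phiHat E' S F V)) x
              - oneillT E' F V (omega E' S F (phiHat E' S F U)) x, W x⟫_ℝ
            = ⟪oneillT E' F U (omega E' S F V) x - oneillT E' F V (omega E' S F U) x,
                phiHat E' S F W x⟫_ℝ
              + ⟪horNabla E' F U (omega E' S F V) x - horNabla E' F V (omega E' S F U) x,
                omega E' S F W x⟫_ℝ := by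
  constructor
  · intro hI U V W hU hV hW x
    have key := h.inner_mlieBracket hS hU hV hW x
    rw [(h.orthogonal x).inner_eq (hI U V hU hV x) (hW.2 x), mul_zero] at key
    linarith
  · intro hI U V hU hV x
    rcases eq_or_ne (Real.sin θ₁) 0 with hθ | hθ
    · rw [h.eq_zero_of_sin_eq_zero hS hθ hU, mlieBracket_zero_left]
      exact (D₁ x).zero_mem
    · refine h.mem_of_inner_eq_zero (h.mlieBracket_mem_vertical hU hV x) fun w hw => ?_
      -- The hypothesis speaks of global sections of D₂, so the test vector is extended to one.
      obtain ⟨W, hW, rfl⟩ := h.smooth₂.exists_isSection hw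
      have key := h.inner_mlieBracket hS hU hV hW x
      rw [hI U V W hU hV hW x, sub_self] at key
      exact (mul_eq_zero.1 key).resolve_left (pow_ne_zero 2 hθ)

end IsBiSlantSubmersion

end BiSlantSubmersion

end BiSlant

theorem theorem3p2
    {E : Type*} [NormedAddCommGroup E] [NormedSpace ℝ E] [FiniteDimensional ℝ E]
    {M : Type*} [TopologicalSpace M] [T2Space M] [SecondCountableTopology M]
    [ChartedSpace E M] [IsManifold 𝓘(ℝ, E) ∞ M]
    [RiemannianBundle (fun x : M => TangentSpace 𝓘(ℝ, E) x)]
    [IsContMDiffRiemannianBundle 𝓘(ℝ, E) ∞ E (fun x : M => TangentSpace 𝓘(ℝ, E) x)]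
    {E' : Type*} [NormedAddCommGroup E'] [NormedSpace ℝ E'] [FiniteDimensional ℝ E']
    {N : Type*} [TopologicalSpace N] [T2Space N] [SecondCountableTopology N]
    [ChartedSpace E' N] [IsManifold 𝓘(ℝ, E') ∞ N]
    [RiemannianBundle (fun y : N => TangentSpace 𝓘(ℝ, E') y)]
    [IsContMDiffRiemannianBundle 𝓘(ℝ, E') ∞ E' (fun y : N => TangentSpace 𝓘(ℝ, E') y)]
    (S : AlmostContactMetric E M) (hS : S.IsSasakian)
    (F : M → N) (D₁ D₂ : ∀ x : M, Submodule ℝ (TangentSpace 𝓘(ℝ, E) x)) (θ₁ θ₂ : ℝ)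
    (hF : IsBiSlantSubmersion E' S F D₁ D₂ θ₁ θ₂) :
    (IsIntegrable D₁ ↔
      ∀ U V W : ∀ x : M, TangentSpace 𝓘(ℝ, E) x,
        IsSection D₁ U → IsSection D₁ V → IsSection D₂ W → ∀ x : M,
          ⟪oneillT E' F U (omega E' S F (phiHat E' S F V)) x
              - oneillT E' F V (omega E' S F (phiHat E' S F U)) x, W x⟫_ℝ
            = ⟪oneillT E' F U (omega E' S F V) x - oneillT E' F V (omega E' S F U) x, phiHat E' S F W x⟫_ℝ
              + ⟪horNabla E' F U (omega E' S F V) x - horNabla E' F V (omega E' S F U) x, omega E' S F W x⟫_ℝ) ∧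
    (IsIntegrable D₂ ↔
      ∀ W Z U : ∀ x : M, TangentSpace 𝓘(ℝ, E) x,
        IsSection D₂ W → IsSection D₂ Z → IsSection D₁ U → ∀ x : M,
          ⟪oneillT E' F W (omega E' S F (phiHat E' S F Z)) x
              - oneillT E' F Z (omega E' S F (phiHat E' S F W)) x, U x⟫_ℝ
            = ⟪oneillT E' F W (omega E' S F Z) x - oneillT E' F Z (omega E' S F W) x, phiHat E' S F U x⟫_ℝ
              + ⟪horNabla E' F W (omega E' S F Z) x - horNabla E' F Z (omega E' S F W) x, omega E' S F U x⟫_ℝ) :=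
  ⟨hF.isIntegrable_left_iff hS, hF.swap.isIntegrable_left_iff hS⟩
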